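/- Let $n,m\ge 0$ be integers, let $\bar A\in\{0,\star\}^{n\times n}$ be symmetrically structured (i.e. $[\bar A]_{ij}=\star$ if and only if $[\bar A]_{ji}=\star$, and the free parameters in positions $(i,j)$ and $(j,i)$ are constrained to take the same value), and let $\bar B\in\{0,\star\}^{n\times m}$ be a structured matrix. A numerical realization $(\tilde A,\tilde B)$ of $(\bar A,\bar B)$ is a pair of real matrices obtained by assigning an arbitrary real number to each independent free parameter; that is, $\tilde A=\tilde A^\top$, $[\tilde A]_{ij}=0$ whenever $[\bar A]_{ij}=0$, and $[\tilde B]_{ij}=0$ whenever $[\bar B]_{ij}=0$. The pair $(\bar A,\bar B)$ is structurally controllable if some numerical realization has a controllability matrix $[\tilde B,\tilde A\tilde B,\dots,\tilde A^{n-1}\tilde B]$ of rank $n$. Let $\mathcal D(\bar A,\bar B)$ be the directed graph with state vertices $\mathcal X=\{x_1,\dots,x_n\}$, input vertices $\mathcal U=\{u_1,\dots,u_m\}$, an edge $(x_j,x_i)$ whenever $[\bar A]_{ij}=\star$, and an edge $(u_j,x_i)$ whenever $[\bar B]_{ij}=\star$. A state vertex is input-reachable if there is a directed path to it from some input vertex.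 For $\mathcal S\subseteq\mathcal X$, let $\mathcal N(\mathcal S)\subseteq\mathcal X\cup\mathcal U$ be the set of vertices $v$ such that $(v,w)$ is an edge for some $w\in\mathcal S$. **Theorem.** $(\bar A,\bar B)$ is structurally controllable if and only if both of the following conditions hold in $\mathcal D(\bar A,\bar B)$: 1. every state vertex is input-reachable; 2. $|\mathcal N(\mathcal S)|\ge|\mathcal S|$ for every $\mathcal S\subseteq\mathcal X$. -/

import Mathlib

namespace StructuralControl

/-- An entry of a structured matrix: a fixed zero, or a free parameter `⋆`. -/
inductive Entry where
  | zero
  | star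

/-- An `n × m` structured matrix, that is, an element of `{0, ⋆}^{n × m}`. -/
abbrev StructuredMatrix (n m : ℕ) := Matrix (Fin n) (Fin m) Entry

/-- An `n × n` symmetrically structured matrix: the pattern is symmetric, and the free parameters
at the positions `(i, j)` and `(j, i)` are one and the same (see `IsRealization` below). -/
structure SymmStructuredMatrix (n : ℕ) where
  pattern : Matrix (Fin n) (Fin n) Entry
  symm : pattern.IsSymm

/-- `M` is a numerical realization of the structured matrix `M'`: the fixed zeros are zero, and the
`⋆`-entries have arbitrary real values (zero included). -/
def StructuredMatrix.IsRealization {n m : ℕ} (M' : StructuredMatrix n m)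
    (M : Matrix (Fin n) (Fin m) ℝ) : Prop :=
  ∀ i j, M' i j = Entry.zero → M i j = 0

/-- `A` is a numerical realization of the symmetrically structured matrix `A'`: the fixed zeros are
zero, the `⋆`-entries have arbitrary real values (zero included), and the entries at `(i, j)` and
`(j, i)`, which carry the same parameter, are equal. -/
def SymmStructuredMatrix.IsRealization {n : ℕ} (A' : SymmStructuredMatrix n)
    (A : Matrix (Fin n) (Fin n) ℝ) : Prop :=
  A.IsSymm ∧ ∀ i j, A'.pattern i j = Entry.zero → A i j = 0

/-- The controllability matrix `[B, A B, …, A^(n-1) B]`; the column `(k, j)` is the `j`-th column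
of the block `A^k B`. -/
def controllabilityMatrix {n m : ℕ} (A : Matrix (Fin n) (Fin n) ℝ)
    (B : Matrix (Fin n) (Fin m) ℝ) : Matrix (Fin n) (Fin n × Fin m) ℝ :=
  Matrix.of fun i kj => (A ^ (kj.1 : ℕ) * B) i kj.2

/-- The pair `(A', B')` is structurally controllable: some numerical realization has a
controllability matrix of full row rank. -/
def StructurallyControllable {n m : ℕ} (A' : SymmStructuredMatrix n)
    (B' : StructuredMatrix n m) : Prop :=
  ∃ (A : Matrix (Fin n) (Fin n) ℝ) (B : Matrix (Fin n) (Fin m) ℝ),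
    A'.IsRealization A ∧ B'.IsRealization B ∧ (controllabilityMatrix A B).rank = n

/-- The edges of the system digraph. The state vertex `x_i` is `Sum.inl i`, the input vertex `u_j`
is `Sum.inr j`; there is an edge `(x_j, x_i)` iff `[A']_{ij} = ⋆` and an edge `(u_j, x_i)` iff
`[B']_{ij} = ⋆`, and no edge ends at an input vertex. -/
def systemAdj {n m : ℕ} (A' : SymmStructuredMatrix n) (B' : StructuredMatrix n m) :
    Fin n ⊕ Fin m → Fin n ⊕ Fin m → Prop
  | Sum.inl j, Sum.inl i => A'.pattern i j = Entry.star
  | Sum.inr j, Sum.inl i => B' i j = Entry.star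
  | _, Sum.inr _ => False

/-- The system digraph of the pair `(A', B')`, on the state vertices and the input vertices. -/
def systemDigraph {n m : ℕ} (A' : SymmStructuredMatrix n) (B' : StructuredMatrix n m) :
    Digraph (Fin n ⊕ Fin m) where
  Adj := systemAdj A' B'

/-- The set of state vertices of the system digraph. -/
def stateVertices (n m : ℕ) : Set (Fin n ⊕ Fin m) := Set.range Sum.inl

/-- The set of input vertices of the system digraph. -/
def inputVertices (n m : ℕ) : Set (Fin n ⊕ Fin m) := Set.range Sum.inr

/-- The in-neighbour set of a set `S` of vertices of a digraph. -/
def inNeighborSet {V : Type*} (D : Digraph V) (S : Set V) : Set V :=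
  {v | ∃ w ∈ S, D.Adj v w}

/-- `v` is reachable from `u` in the digraph `D`: there is a directed path from `u` to `v`. -/
def Reachable {V : Type*} (D : Digraph V) (u v : V) : Prop :=
  Relation.ReflTransGen D.Adj u v

/-- The vertex `v` of the system digraph is input-reachable: it is reachable from some
input vertex. -/
def InputReachable {n m : ℕ} (A' : SymmStructuredMatrix n) (B' : StructuredMatrix n m)
    (v : Fin n ⊕ Fin m) : Prop :=
  ∃ u ∈ inputVertices n m, Reachable (systemDigraph A' B') u v

end StructuralControl

/-! Necessity. States that no input reaches index zero rows of every `A ^ k * B`. If `|N(S)| < |S|`,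
the rows of `[A, B]` indexed by `S` are dependent, and a left null vector of `[A, B]` annihilates
the whole controllability matrix.

Sufficiency. For symmetric `A`, the spectral theorem reduces full rank to a test on real
eigenvectors: none may be annihilated by `B` (`ObservableOn`). Hall's theorem turns condition 2 into
an injection `σ` sending each state to an in-neighbour. Iterating `σ` splits the states into paths
ending at inputs and cycles. The paths, with unit weights, are observable at once. The cycles are
then absorbed one at a time: input-reachability supplies an edge from the part already covered, or
from an input, to a vertex `f` of a new cycle.

A cycle is weighted so that it is nonsingular and no eigenvector vanishes at `f`, then scaled by a
large `t`. An unobservable eigenvector of the coupled system with zero entry at `f` dies in both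
blocks. One with nonzero entry at `f` forces its eigenvalue and its old block into a bounded range
independent of `t`, whereas nonsingularity makes the scaled cycle block too large to balance them.
-/

namespace StructuralControl

open Matrix

/-! ### Observability of symmetric pairs and strong coupling -/

section Observability

variable {ι κ : Type*} [Fintype ι]

/-- No nonzero vector supported on `W` is an eigenvector of `A` annihilated by `B` from the left. -/
def ObservableOn (W : Set ι) (A : Matrix ι ι ℝ) (B : Matrix ι κ ℝ) : Prop :=
  ∀ (c : ℝ) (v : ι → ℝ), (∀ i ∉ W, v i = 0) → A *ᵥ v = c • v → v ᵥ* B = 0 → v = 0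

/-- For a symmetric matrix, observability of eigenvectors implies observability of all vectors. -/
theorem ObservableOn.eq_zero_of_pow [DecidableEq ι] {W : Set ι}
    {A : Matrix ι ι ℝ} {B : Matrix ι κ ℝ}
    (h : ObservableOn W A B) (hs : A.IsSymm) (hW : ∀ i j, i ∉ W → A i j = 0)
    {v : ι → ℝ} (hv : ∀ i ∉ W, v i = 0) (hk : ∀ k : ℕ, (A ^ k *ᵥ v) ᵥ* B = 0) : v = 0 := by
  -- `K` is the unobservable subspace within the vectors supported on `W`. It is `A`-invariant, so
  -- if it were nonzero the symmetric restriction of `A` would have an eigenvector in it.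
  let K : Submodule ℝ (EuclideanSpace ℝ ι) :=
    { carrier := {x | (∀ i ∉ W, x i = 0) ∧ ∀ k : ℕ, (A ^ k *ᵥ x.ofLp) ᵥ* B = 0}
      add_mem' := by
        rintro x y ⟨hx, hx'⟩ ⟨hy, hy'⟩
        refine ⟨fun i hi => by simp [hx i hi, hy i hi], fun k => ?_⟩
        rw [WithLp.ofLp_add, mulVec_add, add_vecMul, hx', hy', add_zero]
      zero_mem' := by simp
      smul_mem' := by
        rintro c x ⟨hx, hx'⟩
        refine ⟨fun i hi => by simp [hx i hi], fun k => ?_⟩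
        rw [WithLp.ofLp_smul, mulVec_smul, smul_vecMul, hx', smul_zero] }
  let T : EuclideanSpace ℝ ι →ₗ[ℝ] EuclideanSpace ℝ ι := Matrix.toEuclideanLin A
  have hT : T.IsSymmetric := by
    refine (Matrix.isSymmetric_toEuclideanLin_iff (A := A)).2 ?_
    rw [Matrix.IsHermitian, Matrix.conjTranspose_eq_transpose_of_trivial]
    exact hs
  have hTa : ∀ x, (T x).ofLp = A *ᵥ x.ofLp := fun x => rfl
  have hinv : ∀ x ∈ K, T x ∈ K := by
    rintro x ⟨hx, hx'⟩
    refine ⟨fun i hi => ?_, fun k => ?_⟩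
    · rw [hTa]
      exact Finset.sum_eq_zero fun j _ => by simp [hW i j hi]
    · rw [hTa, mulVec_mulVec, ← pow_succ]
      exact hx' (k + 1)
  by_contra hne
  have hvK : WithLp.toLp 2 v ∈ K := ⟨hv, hk⟩
  have : Nontrivial K := by
    refine ⟨⟨⟨_, hvK⟩, 0, fun h0 => hne ?_⟩⟩
    have := congrArg (fun x : K => (x : EuclideanSpace ℝ ι).ofLp) h0
    simpa using this
  have hev := (hT.restrict_invariant hinv).hasEigenvalue_iSup_of_finiteDimensional
  obtain ⟨x, hx⟩ := hev.exists_hasEigenvector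
  have hx1 := hx.apply_eq_smul
  have hx2 := congrArg (fun x : K => (x : EuclideanSpace ℝ ι).ofLp) hx1
  apply hx.2
  apply Subtype.ext
  apply WithLp.ofLp_injective
  exact h _ _ x.2.1 hx2 (by simpa using x.2.2 0)

/-- A uniform lower bound for the Popov–Belevitch–Hautus map at bounded spectral parameters. -/
theorem exists_norm_le_of_observable [Fintype κ] {W : Set ι} {A : Matrix ι ι ℝ}
    {B : Matrix ι κ ℝ} {R : ℝ}
    (h : ∀ (c : ℝ) (v : ι → ℝ), |c| ≤ R → (∀ i ∉ W, v i = 0) →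
      A *ᵥ v = c • v → v ᵥ* B = 0 → v = 0) :
    ∃ K, 0 ≤ K ∧ ∀ (c : ℝ) (w : ι → ℝ), |c| ≤ R → (∀ i ∉ W, w i = 0) →
      ‖w‖ ≤ K * (‖A *ᵥ w - c • w‖ + ‖w ᵥ* B‖) := by
  -- The right-hand norm is continuous and positive on this compact set, so it has a positive lower
  -- bound `δ` there; homogeneity in `w` gives `K = δ⁻¹`.
  let Z : Set (ℝ × (ι → ℝ)) :=
    (Set.Icc (-R) R ×ˢ Metric.sphere 0 1) ∩ {p | ∀ i ∉ W, p.2 i = 0}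
  have hZ : IsCompact Z := by
    refine (isCompact_Icc.prod (isCompact_sphere 0 1)).inter_right ?_
    simp only [Set.ofPred_forall]
    exact isClosed_iInter fun i => isClosed_iInter fun _ =>
      isClosed_eq (by fun_prop) continuous_const
  obtain ⟨δ, hδ, hmin⟩ := hZ.exists_forall_le' (a := 0)
    (f := fun p => ‖A *ᵥ p.2 - p.1 • p.2‖ + ‖p.2 ᵥ* B‖) (by fun_prop) (by
      rintro ⟨c, w⟩ ⟨⟨hc, hw⟩, hs⟩
      by_contra hle
      have h1 := norm_nonneg (A *ᵥ w - c • w)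
      have h2 := norm_nonneg (w ᵥ* B)
      simp only [not_lt] at hle
      have h3 : ‖A *ᵥ w - c • w‖ = 0 := by linarith
      have h4 : ‖w ᵥ* B‖ = 0 := by linarith
      have := h c w (abs_le.2 hc) hs (sub_eq_zero.1 (norm_eq_zero.1 h3)) (norm_eq_zero.1 h4)
      simp [this] at hw)
  refine ⟨δ⁻¹, by positivity, fun c w hc hw => ?_⟩
  rcases eq_or_ne w 0 with rfl | hne
  · simp
  have hn : 0 < ‖w‖ := norm_pos_iff.2 hne
  have := hmin (c, ‖w‖⁻¹ • w) ⟨⟨abs_le.1 hc, by simp [norm_smul, hn.ne']⟩, fun i hi => by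
    simp [hw i hi]⟩
  simp only [mulVec_smul, smul_vecMul, smul_comm c, ← smul_sub, norm_smul, norm_inv, norm_norm,
    ← mul_add] at this
  rw [inv_mul_eq_div, le_div_iff₀ hδ, mul_comm]
  rwa [inv_mul_eq_div, le_div_iff₀ hn] at this

/-- The spectral parameters at which the forcing `(a, β)` is invisible to the output are bounded. -/
theorem ObservableOn.exists_abs_le [DecidableEq ι] [Fintype κ] {W : Set ι}
    {A : Matrix ι ι ℝ} {B : Matrix ι κ ℝ}
    (h : ObservableOn W A B) (hs : A.IsSymm) (hW : ∀ i j, i ∉ W → A i j = 0)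
    {a : ι → ℝ} {β : κ → ℝ} (ha : ∀ i ∉ W, a i = 0) (hne : a ≠ 0 ∨ β ≠ 0) :
    ∃ R, 0 ≤ R ∧ ∀ (c : ℝ) (w : ι → ℝ), A *ᵥ w + a = c • w → w ᵥ* B + β = 0 → |c| ≤ R := by
  by_contra! hcon
  have hseq : ∀ N : ℕ, ∃ (c : ℝ) (w : ι → ℝ),
      A *ᵥ w + a = c • w ∧ w ᵥ* B + β = 0 ∧ (N : ℝ) < |c| := by
    intro N
    exact hcon N (Nat.cast_nonneg N)
  choose c w hcw hwB hc using hseq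
  have hc' : Filter.Tendsto (fun N => |c N|) Filter.atTop Filter.atTop :=
    Filter.tendsto_atTop_mono (fun N => (hc N).le) tendsto_natCast_atTop_atTop
  let T : (ι → ℝ) →L[ℝ] (ι → ℝ) := LinearMap.toContinuousLinearMap (Matrix.mulVecLin A)
  -- From `c w = A w + a` follows `‖w‖ ≤ ‖a‖ / (|c| - ‖A‖)` once `|c| > ‖A‖`.
  have hw0 : Filter.Tendsto w Filter.atTop (nhds 0) := by
    have hlim : Filter.Tendsto (fun N => ‖a‖ / (|c N| - ‖T‖)) Filter.atTop (nhds 0) :=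
      Filter.Tendsto.div_atTop tendsto_const_nhds
        (Filter.tendsto_atTop_add_const_right _ (-‖T‖) hc')
    refine squeeze_zero_norm' ?_ hlim
    filter_upwards [hc'.eventually_gt_atTop ‖T‖] with N hN
    rw [le_div_iff₀ (by linarith)]
    have h1 : ‖c N • w N‖ ≤ ‖T‖ * ‖w N‖ + ‖a‖ := by
      rw [← hcw N]
      exact (norm_add_le _ _).trans (add_le_add (T.le_opNorm (w N)) le_rfl)
    rw [norm_smul, Real.norm_eq_abs] at h1
    linarith
  have hcont : ∀ M : Matrix ι κ ℝ, Filter.Tendsto (fun N => w N ᵥ* M) Filter.atTop (nhds 0) := by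
    intro M
    have : Continuous fun x : ι → ℝ => x ᵥ* M := by fun_prop
    simpa [Function.comp_def] using (this.tendsto 0).comp hw0
  have hβ : β = 0 := by
    have h1 := hcont B
    have h2 : (fun N => w N ᵥ* B) = fun _ => -β := by
      funext N
      exact eq_neg_of_add_eq_zero_left (hwB N)
    rw [h2] at h1
    simpa using tendsto_nhds_unique h1 tendsto_const_nhds
  -- Multiplying `A w + a = c w` by `M` makes `w N ᵥ* (A * M)` the constant `-(a ᵥ* M)`, while it
  -- tends to zero; both therefore vanish. Iterating from `M = B` shows that `a` is unobservable.
  have hstep : ∀ M : Matrix ι κ ℝ, (∀ N, w N ᵥ* M = 0) →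
      a ᵥ* M = 0 ∧ ∀ N, w N ᵥ* (A * M) = 0 := by
    intro M hM
    have key : ∀ N, w N ᵥ* (A * M) + a ᵥ* M = 0 := by
      intro N
      have h1 := congrArg (fun x => x ᵥ* M) (hcw N)
      simp only [add_vecMul, smul_vecMul, hM, smul_zero] at h1
      rwa [← vecMul_transpose, hs.eq, vecMul_vecMul] at h1
    have h1 : a ᵥ* M = 0 := by
      have h2 : (fun N => w N ᵥ* (A * M)) = fun _ => -(a ᵥ* M) := by
        funext N
        exact eq_neg_of_add_eq_zero_left (key N)
      have h3 := hcont (A * M)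
      rw [h2] at h3
      simpa using tendsto_nhds_unique h3 tendsto_const_nhds
    exact ⟨h1, fun N => by simpa [h1] using key N⟩
  have hall : ∀ k : ℕ, ∀ N, w N ᵥ* (A ^ k * B) = 0 := by
    intro k
    induction k with
    | zero => intro N; simpa [hβ] using hwB N
    | succ k ih => rw [pow_succ', Matrix.mul_assoc]; exact (hstep _ ih).2
  have ha0 : a = 0 := by
    refine h.eq_zero_of_pow hs hW ha fun k => ?_
    rw [← vecMul_transpose, (hs.pow k).eq, vecMul_vecMul]
    exact (hstep _ (hall k)).1
  exact hne.elim (fun h => h ha0) (fun h => h hβ)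

/-- Coupling an observable system to a nonsingular one that is observable from the coupling site
`f` leaves no unobservable eigenvector, provided the second system is scaled up enough. -/
theorem ObservableOn.exists_coupling [DecidableEq ι] [Fintype κ] {W C : Set ι}
    {A F : Matrix ι ι ℝ} {B : Matrix ι κ ℝ}
    (h : ObservableOn W A B) (hs : A.IsSymm) (hW : ∀ i j, i ∉ W → A i j = 0)
    {a : ι → ℝ} {β : κ → ℝ} (ha : ∀ i ∉ W, a i = 0) (hne : a ≠ 0 ∨ β ≠ 0) {f : ι}
    (hF : ∀ v : ι → ℝ, (∀ i ∉ C, v i = 0) → F *ᵥ v = 0 → v = 0)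
    (hobs : ∀ (c : ℝ) (v : ι → ℝ), (∀ i ∉ C, v i = 0) → F *ᵥ v = c • v → v f = 0 → v = 0) :
    ∃ t : ℝ, ∀ (c : ℝ) (w g : ι → ℝ), (∀ i ∉ W, w i = 0) → (∀ i ∉ C, g i = 0) →
      A *ᵥ w + g f • a = c • w → w ᵥ* B + g f • β = 0 →
      (a ⬝ᵥ w) • Pi.single f 1 + t • F *ᵥ g = c • g → w = 0 ∧ g = 0 := by
  obtain ⟨R, hR0, hR⟩ := h.exists_abs_le hs hW ha hne
  obtain ⟨K, hK0, hK⟩ :=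
    exists_norm_le_of_observable (R := R) fun c v _ => h c v
  -- Spectral radius bound `R = 0` and no output: only the injectivity of `F` on `C` remains.
  obtain ⟨L, hL0, hL⟩ : ∃ L, 0 ≤ L ∧ ∀ g : ι → ℝ, (∀ i ∉ C, g i = 0) → ‖g‖ ≤ L * ‖F *ᵥ g‖ := by
    obtain ⟨L, hL0, hL⟩ := exists_norm_le_of_observable (W := C) (A := F) (R := 0)
      (B := (0 : Matrix ι ι ℝ)) fun c v hc hv e _ => by
        rw [abs_nonpos_iff.1 hc, zero_smul] at e
        exact hF v hv e
    exact ⟨L, hL0, fun g hg => by simpa using hL 0 g (by simp) hg⟩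
  -- `M` bounds the feedback `a ⬝ᵥ w` when `g f = 1`. The cycle equation then gives `t‖g‖ ≤ L(R‖g‖ +
  -- M) ≤ L(M + R)‖g‖`, which `t = L(M + R) + 1` contradicts.
  set M : ℝ := (∑ i, |a i|) * (K * (‖a‖ + ‖β‖)) with hM
  have hM0 : 0 ≤ M := by positivity
  have ht : 0 < L * (M + R) + 1 := by positivity
  refine ⟨L * (M + R) + 1, fun c w g hw hg e1 e2 e3 => ?_⟩
  set t := L * (M + R) + 1
  by_cases hgf : g f = 0
  · have hw0 : w = 0 := h c w hw (by simpa [hgf] using e1) (by simpa [hgf] using e2)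
    refine ⟨hw0, hobs (t⁻¹ * c) g hg ?_ hgf⟩
    rw [hw0, dotProduct_zero, zero_smul, zero_add] at e3
    rw [mul_smul, ← e3, smul_smul, inv_mul_cancel₀ ht.ne', one_smul]
  · exfalso
    obtain ⟨w', hw'⟩ : ∃ w', w' = (g f)⁻¹ • w := ⟨_, rfl⟩
    obtain ⟨g', hg'⟩ : ∃ g', g' = (g f)⁻¹ • g := ⟨_, rfl⟩
    have hgf' : g' f = 1 := by simp [hg', hgf]
    have e1' : A *ᵥ w' + a = c • w' := by
      have := congrArg (fun x => (g f)⁻¹ • x) e1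
      simpa only [smul_add, smul_smul, inv_mul_cancel₀ hgf, one_smul, ← mulVec_smul, ← hw',
        smul_comm _ c] using this
    have e2' : w' ᵥ* B + β = 0 := by
      have := congrArg (fun x => (g f)⁻¹ • x) e2
      simpa only [smul_add, smul_smul, inv_mul_cancel₀ hgf, one_smul, ← smul_vecMul, ← hw',
        smul_zero] using this
    have e3' : (a ⬝ᵥ w') • Pi.single f 1 + t • F *ᵥ g' = c • g' := by
      have := congrArg (fun x => (g f)⁻¹ • x) e3
      rw [hw', hg', dotProduct_smul, mulVec_smul, smul_comm t, smul_assoc, smul_comm c, ← this,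
        smul_add]
    have hcR : |c| ≤ R := hR c w' e1' e2'
    have hwn : ‖w'‖ ≤ K * (‖a‖ + ‖β‖) := by
      have h1 := hK c w' hcR (fun i hi => by simp [hw', hw i hi])
      have h2 : A *ᵥ w' - c • w' = -a := by rw [← e1']; abel
      rwa [h2, eq_neg_of_add_eq_zero_left e2', norm_neg, norm_neg] at h1
    have haw : |a ⬝ᵥ w'| ≤ M := by
      rw [dotProduct, hM, Finset.sum_mul]
      refine (Finset.abs_sum_le_sum_abs _ _).trans (Finset.sum_le_sum fun i _ => ?_)
      rw [abs_mul]
      exact mul_le_mul_of_nonneg_left ((norm_le_pi_norm w' i).trans hwn) (abs_nonneg _)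
    have hg1 : 1 ≤ ‖g'‖ := by
      have := norm_le_pi_norm g' f
      rwa [hgf', norm_one] at this
    have h4 : t * ‖F *ᵥ g'‖ ≤ R * ‖g'‖ + M := by
      have h5 : t • F *ᵥ g' = c • g' - (a ⬝ᵥ w') • Pi.single f 1 := by rw [← e3']; abel
      have h6 : ‖t • F *ᵥ g'‖ = t * ‖F *ᵥ g'‖ := by
        rw [norm_smul, Real.norm_eq_abs, abs_of_pos ht]
      have h7 : ‖(Pi.single f 1 : ι → ℝ)‖ = 1 := by simp [Pi.norm_single]
      rw [← h6, h5]
      refine (norm_sub_le _ _).trans ?_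
      rw [norm_smul, norm_smul, h7, mul_one, Real.norm_eq_abs, Real.norm_eq_abs]
      exact add_le_add (mul_le_mul_of_nonneg_right hcR (norm_nonneg _)) haw
    have h8 := hL g' (fun i hi => by simp [hg', hg i hi])
    have h9 : t * ‖g'‖ ≤ L * (R * ‖g'‖ + M) := by
      calc t * ‖g'‖ ≤ t * (L * ‖F *ᵥ g'‖) := mul_le_mul_of_nonneg_left h8 ht.le
        _ = L * (t * ‖F *ᵥ g'‖) := by ring
        _ ≤ _ := mul_le_mul_of_nonneg_left h4 hL0
    have h10 : L * (R * ‖g'‖ + M) ≤ L * (M + R) * ‖g'‖ := by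
      rw [mul_assoc]
      refine mul_le_mul_of_nonneg_left ?_ hL0
      nlinarith
    have h11 : t * ‖g'‖ = L * (M + R) * ‖g'‖ + ‖g'‖ := by ring
    linarith

end Observability

/-! ### Weighted cycles: nonsingular and observable from one vertex -/

section Cycle

/-- The eigenvector recursion along a cycle of length `n + 2` whose closing edge has weight two. -/
theorem weightedCycle_eq_zero_of_bounds {n : ℕ} {c : ℝ} {y : ℕ → ℝ}
    (hy : ∀ k < n, y (k + 2) + y k = c * y (k + 1))
    (hlast : 2 * y 0 + y n = c * y (n + 1)) (hfirst : y 1 + 2 * y (n + 1) = c * y 0)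
    (h0 : y 0 = 0 ∨ c = 0) : ∀ k ≤ n + 1, y k = 0 := by
  have hrec : y 0 = 0 → y 1 = 0 → ∀ k ≤ n + 1, y k = 0 := by
    intro hy0 hy1 k
    induction k using Nat.twoStepInduction with
    | zero => exact fun _ => hy0
    | one => exact fun _ => hy1
    | more k ih1 ih2 =>
      intro hk
      have := hy k (by omega)
      rw [ih1 (by omega), ih2 (by omega)] at this
      linarith
  rcases h0 with hy0 | rfl
  -- This quadratic form is conserved by the recursion. At the far end it equals `y (n + 1) ^ 2`,
  -- whereas `y 1 = -2 * y (n + 1)`; the weight two is what makes these incompatible unless both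
  -- vanish.
  · have hq : ∀ k ≤ n, y k ^ 2 + y (k + 1) ^ 2 - c * y k * y (k + 1) = y 1 ^ 2 := by
      intro k
      induction k with
      | zero => intro _; simp [hy0]
      | succ k ih =>
        intro hk
        have h1 := hy k (by omega)
        have h2 : y (k + 2) = c * y (k + 1) - y k := by linarith
        rw [← ih (by omega), show k + 1 + 1 = k + 2 from rfl, h2]
        ring
    have h1 := hq n le_rfl
    have h2 : y n = c * y (n + 1) := by linarith
    have h3 : y 1 = -2 * y (n + 1) := by rw [hy0] at hfirst; linarith
    rw [h2, h3] at h1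
    have h4 : y (n + 1) = 0 := by
      have : y (n + 1) ^ 2 = 0 := by nlinarith
      exact pow_eq_zero_iff (two_ne_zero) |>.1 this
    exact hrec hy0 (by rw [h3, h4]; ring)
  -- With `c = 0` the recursion is `y (k + 2) = -y k`, so the closing equations become a linear
  -- system in `y 0` and `y 1`, nonsingular for either parity and sign.
  · have hsgn : ∀ j, (2 * j ≤ n + 1 → y (2 * j) = (-1) ^ j * y 0) ∧
        (2 * j + 1 ≤ n + 1 → y (2 * j + 1) = (-1) ^ j * y 1) := by
      intro j
      induction j with
      | zero => simp
      | succ j ih =>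
        constructor
        · intro hj
          have h1 := hy (2 * j) (by omega)
          have h2 := ih.1 (by omega)
          rw [show 2 * (j + 1) = 2 * j + 2 by ring, pow_succ]
          linarith
        · intro hj
          have h1 := hy (2 * j + 1) (by omega)
          have h2 := ih.2 (by omega)
          rw [show 2 * (j + 1) + 1 = 2 * j + 1 + 2 by ring, pow_succ]
          linarith
    obtain ⟨j, hj⟩ := Nat.even_or_odd' n
    have hpm : ((-1 : ℝ) ^ j) = 1 ∨ ((-1 : ℝ) ^ j) = -1 := neg_one_pow_eq_or ℝ j
    rcases hj with rfl | rfl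
    · have h1 := (hsgn j).1 (by omega)
      have h2 := (hsgn j).2 (by omega)
      rcases hpm with h | h <;> rw [h] at h1 h2 <;> exact hrec (by linarith) (by linarith)
    · have h1 := (hsgn j).2 (by omega)
      have h2 := (hsgn (j + 1)).1 (by omega)
      rw [show 2 * (j + 1) = 2 * j + 1 + 1 by ring, pow_succ] at h2
      rcases hpm with h | h <;> rw [h] at h1 h2 <;> exact hrec (by linarith) (by linarith)

/-- Periodic form of the recursion, suited to reading an eigenvector along the orbit of `f`: indices
divisible by `l` are the visits to `f`. Length one is separate because the loop is then counted from
both sides, giving `4 * y 0 = c * y 0`. -/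
theorem weightedCycle_eq_zero {l : ℕ} (hl : 0 < l) {c : ℝ} {y : ℕ → ℝ}
    (hp : Function.Periodic y l)
    (hy : ∀ k, (if l ∣ k + 2 then 2 else 1) * y (k + 2) + (if l ∣ k + 1 then 2 else 1) * y k =
      c * y (k + 1))
    (h0 : y 0 = 0 ∨ c = 0) (k : ℕ) : y k = 0 := by
  suffices h : ∀ k < l, y k = 0 by
    rw [← hp.map_mod_nat k]
    exact h _ (Nat.mod_lt _ hl)
  match l, hl with
  | 1, _ =>
    intro k hk
    obtain rfl : k = 0 := by omega
    have h1 := hy 0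
    have h2 : y 1 = y 0 := hp 0
    have h3 : y 2 = y 1 := hp 1
    simp only [isUnit_one, IsUnit.dvd, if_true, Nat.zero_add, h3, h2] at h1
    rcases h0 with h0 | rfl
    · exact h0
    · linarith
  | n + 2, _ =>
    have hn2 : y (n + 2) = y 0 := by simpa using hp 0
    have hn3 : y (n + 3) = y 1 := by simpa [add_comm, add_left_comm] using hp 1
    have hnd : ∀ k, 0 < k → k < n + 2 → ¬ (n + 2 ∣ k) :=
      fun k h1 h2 h3 => absurd (Nat.le_of_dvd h1 h3) (by omega)
    have hnd' : ¬ (n + 2 ∣ n + 3) := by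
      rw [show n + 3 = (n + 2) + 1 from rfl, Nat.dvd_add_right (dvd_refl _)]
      exact hnd 1 one_pos (by omega)
    intro k hk
    refine weightedCycle_eq_zero_of_bounds (n := n) (c := c) (fun k hk => ?_) ?_ ?_ h0 k (by omega)
    · have := hy k
      rwa [if_neg (hnd _ (by omega) (by omega)), if_neg (hnd _ (by omega) (by omega)), one_mul,
        one_mul] at this
    · have := hy n
      rwa [if_pos (dvd_refl _), if_neg (hnd _ (by omega) (by omega)), one_mul, hn2] at this
    · have := hy (n + 1)
      rwa [show n + 1 + 2 = n + 3 from rfl, show n + 1 + 1 = n + 2 from rfl,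
        if_neg hnd', if_pos (dvd_refl _), one_mul, hn2, hn3] at this

variable {ι : Type*} [Fintype ι] [DecidableEq ι]

open Classical in
/-- The directed weighted adjacency matrix of the cycle of `τ` through `f`: the edge entering `f`
has weight two, all other edges have weight one. -/
noncomputable def cycleMatrix (τ : Equiv.Perm ι) (f : ι) : Matrix ι ι ℝ :=
  Matrix.of fun i j => if τ.SameCycle f i ∧ τ i = j then (if j = f then 2 else 1) else 0

theorem cycleMatrix_add_transpose_mulVec (τ : Equiv.Perm ι) (f : ι) (v : ι → ℝ) {i : ι}
    (hi : τ.SameCycle f i) :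
    ((cycleMatrix τ f + (cycleMatrix τ f)ᵀ) *ᵥ v) (τ i) =
      (if τ (τ i) = f then 2 else 1) * v (τ (τ i)) + (if τ i = f then 2 else 1) * v i := by
  rw [add_mulVec, Pi.add_apply]
  congr 1
  · have hi' : τ.SameCycle f (τ i) := Equiv.Perm.sameCycle_apply_right.2 hi
    simp only [mulVec, dotProduct, cycleMatrix, of_apply]
    rw [Finset.sum_eq_single (τ (τ i)) _ (by simp)]
    · rw [if_pos ⟨hi', rfl⟩]
    · intro j _ hj
      rw [if_neg (fun h => hj h.2.symm), zero_mul]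
  · simp only [mulVec, dotProduct, cycleMatrix, transpose_apply, of_apply]
    rw [Finset.sum_eq_single i _ (by simp)]
    · rw [if_pos ⟨hi, rfl⟩]
    · intro j _ hj
      rw [if_neg (fun h => hj (τ.injective h.2)), zero_mul]

/-- An eigenvector of a weighted cycle vanishes if it vanishes at `f` or has eigenvalue zero. -/
theorem eq_zero_of_cycleMatrix_eigenvector (τ : Equiv.Perm ι) (f : ι) {c : ℝ} {v : ι → ℝ}
    (hv : ∀ i ∉ {i | τ.SameCycle f i}, v i = 0)
    (he : (cycleMatrix τ f + (cycleMatrix τ f)ᵀ) *ᵥ v = c • v) (h0 : v f = 0 ∨ c = 0) :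
    v = 0 := by
  have hdvd : ∀ k, (τ ^ k) f = f ↔ Function.minimalPeriod τ f ∣ k := by
    intro k
    rw [← Function.isPeriodicPt_iff_minimalPeriod_dvd, Function.IsPeriodicPt,
      Function.IsFixedPt, Equiv.Perm.iterate_eq_pow]
  have hsucc : ∀ k, τ ((τ ^ k) f) = (τ ^ (k + 1)) f := fun k => by
    rw [pow_succ', Equiv.Perm.mul_apply]
  have hl : 0 < Function.minimalPeriod τ f :=
    Function.minimalPeriod_pos_of_mem_periodicPts
      (Function.Injective.mem_periodicPts τ.injective f)
  have hz : ∀ k, v ((τ ^ k) f) = 0 := by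
    refine weightedCycle_eq_zero hl (c := c) (fun k => ?_) (fun k => ?_) (by simpa using h0)
    · simp only [pow_add, Equiv.Perm.mul_apply, (hdvd _).2 (dvd_refl _)]
    · have h1 := congrFun he (τ ((τ ^ k) f))
      rw [cycleMatrix_add_transpose_mulVec τ f v (i := (τ ^ k) f) ⟨k, by simp⟩, Pi.smul_apply,
        hsucc, hsucc] at h1
      simp only [← hdvd]
      exact h1
  funext i
  by_cases hi : τ.SameCycle f i
  · obtain ⟨k, -, hk⟩ := hi.exists_pow_eq'
    rw [← hk]
    exact hz k
  · exact hv i hi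

end Cycle

/-! ### Gluing a cycle block to an observable block -/

section Extension

variable {ι κ : Type*} [Fintype ι] [DecidableEq ι] [Fintype κ]

/-- Observability extends along a coupling to a nonsingular system observable from the
coupling site. -/
theorem ObservableOn.exists_extend {W C : Set ι} {A F : Matrix ι ι ℝ} {B : Matrix ι κ ℝ}
    (h : ObservableOn W A B) (hs : A.IsSymm) (hW : ∀ i j, i ∉ W → A i j = 0)
    (hBW : ∀ i u, i ∉ W → B i u = 0) (hFs : F.IsSymm) (hFC : ∀ i j, i ∉ C → F i j = 0)
    (hWC : Disjoint W C)
    {a : ι → ℝ} {β : κ → ℝ} (ha : ∀ i ∉ W, a i = 0) (hne : a ≠ 0 ∨ β ≠ 0) {f : ι} (hf : f ∈ C)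
    (hF : ∀ v : ι → ℝ, (∀ i ∉ C, v i = 0) → F *ᵥ v = 0 → v = 0)
    (hobs : ∀ (c : ℝ) (v : ι → ℝ), (∀ i ∉ C, v i = 0) → F *ᵥ v = c • v → v f = 0 → v = 0) :
    ∃ t : ℝ, ObservableOn (W ∪ C)
      (A + vecMulVec a (Pi.single f 1) + vecMulVec (Pi.single f 1) a + t • F)
      (B + vecMulVec (Pi.single f 1) β) := by
  obtain ⟨t, ht⟩ := h.exists_coupling hs hW ha hne hF hobs
  refine ⟨t, fun c v hv e1 e2 => ?_⟩
  have hCW : ∀ i ∈ C, i ∉ W := fun i hi hi' => Set.disjoint_left.1 hWC hi' hi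
  obtain ⟨w, hw⟩ : ∃ w : ι → ℝ, w = W.indicator v := ⟨_, rfl⟩
  obtain ⟨g, hg⟩ : ∃ g : ι → ℝ, g = C.indicator v := ⟨_, rfl⟩
  have hvwg : v = w + g := by
    have h1 : (W ∪ C).indicator v = w + g := by
      rw [hw, hg]
      exact Set.indicator_union_of_disjoint hWC v
    rw [← h1]
    funext i
    by_cases hi : i ∈ W ∪ C
    · rw [Set.indicator_of_mem hi]
    · rw [Set.indicator_of_notMem hi, hv i hi]
  have hwW : ∀ i ∉ W, w i = 0 := fun i hi => by rw [hw, Set.indicator_of_notMem hi]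
  have hgC : ∀ i ∉ C, g i = 0 := fun i hi => by rw [hg, Set.indicator_of_notMem hi]
  have hsup : ∀ (U : Set ι) (M : Matrix ι ι ℝ) (x : ι → ℝ), M.IsSymm →
      (∀ i j, i ∉ U → M i j = 0) → (∀ i ∈ U, x i = 0) → M *ᵥ x = 0 := by
    intro U M x hM hMU hx
    funext i
    refine Finset.sum_eq_zero fun j _ => ?_
    by_cases hj : j ∈ U
    · rw [hx j hj, mul_zero]
    · exact mul_eq_zero_of_left ((hM.apply i j).symm.trans (hMU j i hj)) _
  have hAg : A *ᵥ g = 0 := hsup W A g hs hW fun i hi => hgC i fun hi' => hCW i hi' hi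
  have hFw : F *ᵥ w = 0 := hsup C F w hFs hFC fun i hi => hwW i (hCW i hi)
  have hBg : g ᵥ* B = 0 := by
    funext u
    refine Finset.sum_eq_zero fun i _ => ?_
    by_cases hi : i ∈ C
    · exact mul_eq_zero_of_right _ (hBW i u (hCW i hi))
    · rw [hgC i hi, zero_mul]
  have hag : a ⬝ᵥ g = 0 := by
    refine Finset.sum_eq_zero fun i _ => ?_
    by_cases hi : i ∈ C
    · rw [ha i (hCW i hi), zero_mul]
    · rw [hgC i hi, mul_zero]
  have hwf : w f = 0 := hwW f (hCW f hf)
  have e1' : A *ᵥ w + g f • a + (a ⬝ᵥ w) • Pi.single f 1 + t • F *ᵥ g = c • w + c • g := by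
    rw [← smul_add, ← hvwg, ← e1, hvwg]
    simp only [add_mulVec, mulVec_add, smul_mulVec, vecMulVec_mulVec, hAg, hFw, hag, hwf,
      single_dotProduct, op_smul_eq_smul, one_mul, zero_add, add_zero, zero_smul, smul_zero]
    abel
  have e2' : w ᵥ* B + g f • β = 0 := by
    rw [← e2, hvwg]
    simp [add_vecMul, vecMul_add, vecMul_vecMulVec, hBg, hwf]
  have hAw : ∀ i ∉ W, (A *ᵥ w) i = 0 := fun i hi =>
    Finset.sum_eq_zero fun j _ => by simp [hW i j hi]
  have hFg : ∀ i ∉ C, (F *ᵥ g) i = 0 := fun i hi =>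
    Finset.sum_eq_zero fun j _ => by simp [hFC i j hi]
  -- The two vector equations have disjoint supports `W` and `C`, so their sum separates
  -- coordinatewise.
  have hsplit : A *ᵥ w + g f • a = c • w ∧
      (a ⬝ᵥ w) • Pi.single f 1 + t • F *ᵥ g = c • g := by
    constructor <;> funext i <;> have h1 := congrFun e1' i <;>
      simp only [Pi.add_apply, Pi.smul_apply, smul_eq_mul] at h1 ⊢
    · by_cases hi : i ∈ W
      · have hiC : i ∉ C := fun h => hCW i h hi
        have hif : i ≠ f := fun h => hiC (h ▸ hf)
        rw [hFg i hiC, hgC i hiC, Pi.single_eq_of_ne hif] at h1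
        linarith
      · rw [hAw i hi, ha i hi, hwW i hi]
        ring
    · by_cases hi : i ∈ W
      · have hiC : i ∉ C := fun h => hCW i h hi
        have hif : i ≠ f := fun h => hiC (h ▸ hf)
        rw [hFg i hiC, hgC i hiC, Pi.single_eq_of_ne hif]
        ring
      · rw [hAw i hi, ha i hi, hwW i hi] at h1
        linarith
  obtain ⟨h1, h2⟩ := ht c w g hwW hgC hsplit.1 e2' hsplit.2
  rw [hvwg, h1, h2, add_zero]

end Extension

/-! ### Paths ending at inputs -/

section Path

variable {ι κ : Type*}

/-- The state `x` is led to an input by iterating `σ`. -/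
inductive EndsAtInput (σ : ι → ι ⊕ κ) : ι → Prop
  | last {x : ι} {u : κ} : σ x = Sum.inr u → EndsAtInput σ x
  | step {x y : ι} : σ x = Sum.inl y → EndsAtInput σ y → EndsAtInput σ x

theorem endsAtInput_iff_of_eq_inl {σ : ι → ι ⊕ κ} {x y : ι} (h : σ x = Sum.inl y) :
    EndsAtInput σ x ↔ EndsAtInput σ y := by
  refine ⟨fun hx => ?_, .step h⟩
  cases hx with
  | last h' => simp [h] at h'
  | step h' hy => rw [h, Sum.inl.injEq] at h'; exact h' ▸ hy

variable [Fintype ι] [DecidableEq ι] [DecidableEq κ]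

open Classical in
/-- The directed adjacency matrix, among the states, of the paths of `σ` that end at an input. -/
noncomputable def pathMatrix (σ : ι → ι ⊕ κ) : Matrix ι ι ℝ :=
  Matrix.of fun i j => if EndsAtInput σ i ∧ σ i = Sum.inl j then 1 else 0

/-- The adjacency matrix between the states and the inputs to which `σ` sends them. -/
noncomputable def pathInputMatrix (σ : ι → ι ⊕ κ) : Matrix ι κ ℝ :=
  Matrix.of fun i u => if σ i = Sum.inr u then 1 else 0

/-- The output kills the entry next to the input. The eigenvalue equation at each state then
expresses the entry one step farther from the input through entries already known to vanish.
Injectivity of `σ` keeps the paths disjoint. -/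
theorem observableOn_pathMatrix {σ : ι → ι ⊕ κ} (hσ : Function.Injective σ) :
    ObservableOn {i | EndsAtInput σ i} (pathMatrix σ + (pathMatrix σ)ᵀ) (pathInputMatrix σ) := by
  intro c v hv e1 e2
  have hlast : ∀ x u, σ x = Sum.inr u → v x = 0 := by
    intro x u hx
    have h1 := congrFun e2 u
    simp only [vecMul, dotProduct, pathInputMatrix, of_apply] at h1
    rw [Finset.sum_eq_single x _ (by simp), if_pos hx, mul_one] at h1
    · exact h1
    · intro j _ hj
      rw [if_neg (fun h => hj (hσ (h.trans hx.symm))), mul_zero]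
  have hrow : ∀ x y, EndsAtInput σ x → σ x = Sum.inl y → v y = 0 →
      (∀ z, σ y = Sum.inl z → v z = 0) → v x = 0 := by
    intro x y hx hxy hy hz
    have h1 := congrFun e1 y
    rw [add_mulVec, Pi.add_apply, Pi.smul_apply, hy, smul_zero] at h1
    have h2 : (pathMatrix σ *ᵥ v) y = 0 := by
      refine Finset.sum_eq_zero fun j _ => ?_
      by_cases hj : σ y = Sum.inl j
      · rw [hz j hj, mul_zero]
      · simp [pathMatrix, hj]
    have h3 : ((pathMatrix σ)ᵀ *ᵥ v) y = v x := by
      simp only [mulVec, dotProduct, pathMatrix, transpose_apply, of_apply]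
      rw [Finset.sum_eq_single x _ (by simp), if_pos ⟨hx, hxy⟩, one_mul]
      intro j _ hj
      rw [if_neg (fun h => hj (hσ (h.2.trans hxy.symm))), zero_mul]
    rw [h2, h3, zero_add] at h1
    exact h1
  have hall : ∀ x, EndsAtInput σ x → v x = 0 ∧ ∀ z, σ x = Sum.inl z → v z = 0 := by
    intro x hx
    induction hx with
    | last h => exact ⟨hlast _ _ h, fun z hz => by simp [h] at hz⟩
    | step h hy ih =>
      refine ⟨hrow _ _ (.step h hy) h ih.1 ih.2, fun z hz => ?_⟩
      rw [h, Sum.inl.injEq] at hz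
      exact hz ▸ ih.1
  funext i
  by_cases hi : EndsAtInput σ i
  · exact (hall i hi).1
  · exact hv i hi

end Path

/-! ### From observability to the rank of the controllability matrix -/

section Rank

variable {n m : ℕ}

/-- Full row rank means that the left kernel is trivial. -/
theorem controllabilityMatrix_rank_eq_iff (A : Matrix (Fin n) (Fin n) ℝ)
    (B : Matrix (Fin n) (Fin m) ℝ) :
    (controllabilityMatrix A B).rank = n ↔
      ∀ v : Fin n → ℝ, (∀ k < n, v ᵥ* (A ^ k * B) = 0) → v = 0 := by
  have h1 : (controllabilityMatrix A B).rank = n ↔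
      LinearIndependent ℝ (controllabilityMatrix A B).row := by
    rw [linearIndependent_iff_card_eq_finrank_span, rank_eq_finrank_span_row, Fintype.card_fin,
      eq_comm]
    rfl
  have h2 : ∀ v : Fin n → ℝ, v ᵥ* controllabilityMatrix A B = 0 ↔
      ∀ k < n, v ᵥ* (A ^ k * B) = 0 := by
    intro v
    constructor
    · intro h k hk
      funext j
      exact congrFun h (⟨k, hk⟩, j)
    · intro h
      funext kj
      exact congrFun (h kj.1 kj.1.2) kj.2
  rw [h1, ← vecMul_injective_iff, ← Matrix.coe_vecMulLinear, ← LinearMap.ker_eq_bot,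
    LinearMap.ker_eq_bot']
  exact forall_congr' fun v => by rw [Matrix.vecMulLinear_apply, h2]

/-- An observable symmetric pair has a controllability matrix of full row rank. -/
theorem ObservableOn.rank_controllabilityMatrix {A : Matrix (Fin n) (Fin n) ℝ}
    {B : Matrix (Fin n) (Fin m) ℝ} (h : ObservableOn Set.univ A B) (hs : A.IsSymm) :
    (controllabilityMatrix A B).rank = n := by
  rw [controllabilityMatrix_rank_eq_iff]
  intro v hv
  refine h.eq_zero_of_pow hs (by simp) (by simp) fun k => ?_
  rw [← vecMul_transpose, (hs.pow k).eq, vecMul_vecMul]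
  induction k using Nat.strong_induction_on with
  | _ k ih =>
    by_cases hk : k < n
    · exact hv k hk
    · obtain ⟨l, rfl⟩ := Nat.exists_eq_add_of_le' (not_lt.1 hk)
      -- Cayley–Hamilton: for exponents at least `n`, `A ^ (l + n)` is a combination of lower
      -- powers.
      have hdeg := A.charpoly_natDegree_eq_dim
      rw [Fintype.card_fin] at hdeg
      have hch := A.aeval_self_charpoly
      rw [Polynomial.aeval_eq_sum_range, hdeg, Finset.sum_range_succ] at hch
      have hlead : A.charpoly.coeff n = 1 := by
        have := A.charpoly_monic
        rwa [Polynomial.Monic, Polynomial.leadingCoeff, hdeg] at this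
      rw [hlead, one_smul] at hch
      have hpow : A ^ (l + n) * B =
          -∑ i ∈ Finset.range n, A.charpoly.coeff i • (A ^ (l + i) * B) := by
        rw [pow_add, eq_neg_of_add_eq_zero_right hch]
        simp only [Matrix.mul_neg, Matrix.neg_mul, Matrix.mul_sum, Matrix.sum_mul,
          Matrix.mul_smul, Matrix.smul_mul, pow_add]
      rw [hpow, vecMul_neg, neg_eq_zero]
      have hsum : ∀ s : Finset ℕ, (∀ i ∈ s, v ᵥ* (A ^ (l + i) * B) = 0) →
          v ᵥ* (∑ i ∈ s, A.charpoly.coeff i • (A ^ (l + i) * B)) = 0 := by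
        intro s
        induction s using Finset.induction_on with
        | empty => simp
        | insert a s ha ihs =>
          intro hi
          rw [Finset.sum_insert ha, vecMul_add, vecMul_smul, hi a (Finset.mem_insert_self _ _),
            ihs fun i his => hi i (Finset.mem_insert_of_mem his), smul_zero, add_zero]
      refine hsum _ fun i hi => ih _ ?_
      have := Finset.mem_range.1 hi
      omega

end Rank

theorem Entry.eq_zero_or_eq_star (e : Entry) : e = Entry.zero ∨ e = Entry.star := by
  cases e <;> simp

/-! ### Necessity of the two conditions -/

section Necessity

variable {n m : ℕ} {A' : SymmStructuredMatrix n} {B' : StructuredMatrix n m}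

theorem StructurallyControllable.inputReachable (h : StructurallyControllable A' B')
    (i : Fin n) : InputReachable A' B' (Sum.inl i) := by
  obtain ⟨A, B, hA, hB, hrank⟩ := h
  by_contra hi
  have hzero : ∀ k : ℕ, ∀ i, ¬ InputReachable A' B' (Sum.inl i) → ∀ j, (A ^ k * B) i j = 0 := by
    intro k
    induction k with
    | zero =>
      intro i hi j
      rw [pow_zero, Matrix.one_mul]
      refine hB i j ((Entry.eq_zero_or_eq_star _).resolve_right fun hs => hi ?_)
      exact ⟨Sum.inr j, ⟨j, rfl⟩, .single hs⟩
    | succ k ih =>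
      intro i hi j
      rw [pow_succ', Matrix.mul_assoc, Matrix.mul_apply]
      refine Finset.sum_eq_zero fun l _ => ?_
      rcases Entry.eq_zero_or_eq_star (A'.pattern i l) with h0 | hs
      · rw [hA.2 i l h0, zero_mul]
      · rw [ih l (fun ⟨u, hu, hp⟩ => hi ⟨u, hu, hp.tail hs⟩), mul_zero]
  have h1 := (controllabilityMatrix_rank_eq_iff A B).1 hrank (Pi.single i 1) fun k _ => by
    funext j
    simpa using hzero k i hi j
  simpa using congrFun h1 i

/-- Rows of `[A, B]` indexed by `S` live in the columns `N(S)`. Full controllability rank makes them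
independent, so `ℝ^S` embeds into `ℝ^N(S)`. -/
theorem StructurallyControllable.ncard_le_inNeighborSet (h : StructurallyControllable A' B')
    (S : Set (Fin n)) :
    S.ncard ≤ (inNeighborSet (systemDigraph A' B') (Sum.inl '' S)).ncard := by
  classical
  obtain ⟨A, B, hA, hB, hrank⟩ := h
  set N := inNeighborSet (systemDigraph A' B') (Sum.inl '' S) with hN
  let M : Matrix (Fin n) (Fin n ⊕ Fin m) ℝ := fromCols A B
  have hM : ∀ i ∈ S, ∀ p ∉ N, M i p = 0 := by
    rintro i hi (j | j) hp
    · exact hA.2 i j ((Entry.eq_zero_or_eq_star _).resolve_right fun hs =>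
        hp ⟨Sum.inl i, ⟨i, hi, rfl⟩, hs⟩)
    · exact hB i j ((Entry.eq_zero_or_eq_star _).resolve_right fun hs =>
        hp ⟨Sum.inl i, ⟨i, hi, rfl⟩, hs⟩)
  let f : (S → ℝ) →ₗ[ℝ] (N → ℝ) :=
    (M.submatrix (Subtype.val : S → _) (Subtype.val : N → _)).vecMulLinear
  have hf : Function.Injective f := by
    rw [← LinearMap.ker_eq_bot, LinearMap.ker_eq_bot']
    intro v hv
    let w : Fin n → ℝ := fun i => if hi : i ∈ S then v ⟨i, hi⟩ else 0
    have hwM : w ᵥ* M = 0 := by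
      funext p
      by_cases hp : p ∈ N
      · have h1 := congrFun hv ⟨p, hp⟩
        refine Eq.trans ?_ h1
        change ∑ i, w i * M i p = ∑ i : S, v i * M i p
        rw [← Fintype.sum_subtype_add_sum_subtype (· ∈ S) fun i => w i * M i p,
          Finset.sum_eq_zero fun (i : {i // i ∉ S}) _ => by simp [w, i.2], add_zero]
        exact Finset.sum_congr rfl fun i _ => by simp [w, i.2]
      · change ∑ i, w i * M i p = 0
        refine Finset.sum_eq_zero fun i _ => ?_
        by_cases hi : i ∈ S
        · exact mul_eq_zero_of_right _ (hM i hi p hp)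
        · simp [w, hi]
    have hwA : w ᵥ* A = 0 := funext fun j => congrFun hwM (Sum.inl j)
    have hwB : w ᵥ* B = 0 := funext fun j => congrFun hwM (Sum.inr j)
    have hw0 : w = 0 := by
      refine (controllabilityMatrix_rank_eq_iff A B).1 hrank w fun k _ => ?_
      cases k with
      | zero => simpa using hwB
      | succ k => rw [pow_succ', Matrix.mul_assoc, ← vecMul_vecMul, hwA, zero_vecMul]
    funext i
    simpa [w] using congrFun hw0 i
  have := LinearMap.finrank_le_finrank_of_injective hf
  rwa [Module.finrank_fintype_fun_eq_card, Module.finrank_fintype_fun_eq_card,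
    ← Nat.card_eq_fintype_card, ← Nat.card_eq_fintype_card, Nat.card_coe_set_eq,
    Nat.card_coe_set_eq] at this

end Necessity

/-! ### Sufficiency: building an observable realization -/

section Sufficiency

variable {n m : ℕ} {A' : SymmStructuredMatrix n} {B' : StructuredMatrix n m}

/-- Some realization of `(A', B')` supported on the states in `W` is observable on `W`. -/
def HasObservableRealization (A' : SymmStructuredMatrix n) (B' : StructuredMatrix n m)
    (W : Set (Fin n)) : Prop :=
  ∃ (A : Matrix (Fin n) (Fin n) ℝ) (B : Matrix (Fin n) (Fin m) ℝ),
    A'.IsRealization A ∧ B'.IsRealization B ∧ (∀ i j, i ∉ W → A i j = 0) ∧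
      (∀ i u, i ∉ W → B i u = 0) ∧ ObservableOn W A B

theorem SymmStructuredMatrix.IsRealization.add {A₁ A₂ : Matrix (Fin n) (Fin n) ℝ}
    (h₁ : A'.IsRealization A₁) (h₂ : A'.IsRealization A₂) : A'.IsRealization (A₁ + A₂) :=
  ⟨h₁.1.add h₂.1, fun i j h => by rw [Matrix.add_apply, h₁.2 i j h, h₂.2 i j h, add_zero]⟩

theorem SymmStructuredMatrix.IsRealization.smul {A : Matrix (Fin n) (Fin n) ℝ}
    (h : A'.IsRealization A) (t : ℝ) : A'.IsRealization (t • A) :=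
  ⟨h.1.smul t, fun i j h0 => by rw [Matrix.smul_apply, h.2 i j h0, smul_zero]⟩

theorem SymmStructuredMatrix.isRealization_add_transpose {D : Matrix (Fin n) (Fin n) ℝ}
    (h : ∀ i j, A'.pattern i j = Entry.zero → D i j = 0) : A'.IsRealization (D + Dᵀ) := by
  refine ⟨by rw [Matrix.IsSymm, transpose_add, transpose_transpose, add_comm], fun i j h0 => ?_⟩
  rw [Matrix.add_apply, transpose_apply, h i j h0, h j i ((A'.symm.apply i j).trans h0), add_zero]

/-- The union of the paths that end at an input has an observable realization. -/
theorem hasObservableRealization_endsAtInput {σ : Fin n → Fin n ⊕ Fin m}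
    (hσ : Function.Injective σ) (hadj : ∀ i, systemAdj A' B' (σ i) (Sum.inl i)) :
    HasObservableRealization A' B' {i | EndsAtInput σ i} := by
  refine ⟨_, pathInputMatrix σ, SymmStructuredMatrix.isRealization_add_transpose ?_, ?_, ?_, ?_,
    observableOn_pathMatrix hσ⟩
  · intro i j h0
    refine if_neg fun h => ?_
    have := hadj i
    rw [h.2] at this
    exact Entry.noConfusion (h0.symm.trans this)
  · intro i u h0
    refine if_neg fun h => ?_
    have := hadj i
    rw [h] at this
    exact Entry.noConfusion (h0.symm.trans this)
  · intro i j hi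
    have h1 : pathMatrix σ i j = 0 := if_neg fun h => hi h.1
    have h2 : pathMatrix σ j i = 0 := if_neg fun h => hi ((endsAtInput_iff_of_eq_inl h.2).1 h.1)
    rw [Matrix.add_apply, transpose_apply, h1, h2, add_zero]
  · intro i u hi
    exact if_neg fun h => hi (.last h)

/-- An observable realization extends along a cycle adjacent to the states it covers or to an
input. -/
theorem HasObservableRealization.union_cycle {W : Set (Fin n)}
    (h : HasObservableRealization A' B' W) {τ : Equiv.Perm (Fin n)}
    {f : Fin n} (hfW : ∀ i, τ.SameCycle f i → i ∉ W)
    (hadj : ∀ i, τ.SameCycle f i → A'.pattern i (τ i) = Entry.star)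
    {a : Fin n → ℝ} {β : Fin m → ℝ} (ha : ∀ i ∉ W, a i = 0) (hne : a ≠ 0 ∨ β ≠ 0)
    (ha' : ∀ i, A'.pattern i f = Entry.zero → a i = 0)
    (hβ' : ∀ u, B' f u = Entry.zero → β u = 0) :
    HasObservableRealization A' B' (W ∪ {i | τ.SameCycle f i}) := by
  obtain ⟨A, B, hA, hB, hAW, hBW, hobs⟩ := h
  have hF : A'.IsRealization (cycleMatrix τ f + (cycleMatrix τ f)ᵀ) := by
    refine SymmStructuredMatrix.isRealization_add_transpose fun i j h0 => if_neg fun h => ?_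
    have := hadj i h.1
    rw [h.2] at this
    exact Entry.noConfusion (h0.symm.trans this)
  have hFC : ∀ i j, i ∉ {i | τ.SameCycle f i} →
      (cycleMatrix τ f + (cycleMatrix τ f)ᵀ) i j = 0 := by
    intro i j hi
    have h1 : cycleMatrix τ f i j = 0 := if_neg fun h => hi h.1
    have h2 : cycleMatrix τ f j i = 0 :=
      if_neg fun h : τ.SameCycle f j ∧ τ j = i =>
        hi (h.2 ▸ Equiv.Perm.sameCycle_apply_right.2 h.1)
    rw [Matrix.add_apply, transpose_apply, h1, h2, add_zero]
  obtain ⟨t, ht⟩ := hobs.exists_extend hA.1 hAW hBW hF.1 hFC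
    (Set.disjoint_left.2 fun i hi hi' => hfW i hi' hi) ha hne (f := f) (.refl τ f)
    (fun v hv e => eq_zero_of_cycleMatrix_eigenvector τ f (c := 0) hv (by rw [e, zero_smul])
      (.inr rfl))
    (fun c v hv e h0 => eq_zero_of_cycleMatrix_eigenvector τ f hv e (.inl h0))
  have hD : A'.IsRealization (vecMulVec a (Pi.single f 1) + (vecMulVec a (Pi.single f 1))ᵀ) := by
    refine SymmStructuredMatrix.isRealization_add_transpose fun i j h0 => ?_
    rw [vecMulVec_apply]
    by_cases hj : j = f
    · rw [ha' i (hj ▸ h0), zero_mul]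
    · rw [Pi.single_eq_of_ne hj, mul_zero]
  rw [transpose_vecMulVec] at hD
  refine ⟨_, _, ?_, ?_, ?_, ?_, ht⟩
  · rw [add_assoc A]
    exact (hA.add hD).add (hF.smul t)
  · intro i u h0
    rw [Matrix.add_apply, hB i u h0, vecMulVec_apply, zero_add]
    by_cases hi : i = f
    · rw [hβ' u (hi ▸ h0), mul_zero]
    · rw [Pi.single_eq_of_ne hi, zero_mul]
  · intro i j hi
    have hiW : i ∉ W := fun h => hi (.inl h)
    have hiC : i ∉ {i | τ.SameCycle f i} := fun h => hi (.inr h)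
    have hif : i ≠ f := fun h => hiC (h ▸ .refl τ f)
    simp only [Matrix.add_apply, Matrix.smul_apply, vecMulVec_apply] at hFC ⊢
    rw [hAW i j hiW, ha i hiW, hFC i j hiC, Pi.single_eq_of_ne hif]
    simp
  · intro i u hi
    have hif : i ≠ f := fun h => hi (.inr (h ▸ .refl τ f))
    rw [Matrix.add_apply, hBW i u (fun h => hi (.inl h)), vecMulVec_apply,
      Pi.single_eq_of_ne hif, zero_mul, add_zero]

/-- Outside the paths that end at an input, a matching of the states permutes the states. -/
theorem exists_perm_of_matching {ι κ : Type*} [Finite ι] {σ : ι → ι ⊕ κ}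
    (hσ : Function.Injective σ) :
    ∃ τ : Equiv.Perm ι, (∀ i, EndsAtInput σ i → τ i = i) ∧
      ∀ i, ¬ EndsAtInput σ i → σ i = Sum.inl (τ i) := by
  classical
  have h1 : ∀ i, ∃ j, (EndsAtInput σ i → j = i) ∧ (¬ EndsAtInput σ i → σ i = Sum.inl j) := by
    intro i
    by_cases hi : EndsAtInput σ i
    · exact ⟨i, fun _ => rfl, fun h => absurd hi h⟩
    · rcases hs : σ i with j | u
      · exact ⟨j, fun h => absurd h hi, fun _ => rfl⟩
      · exact absurd (.last hs) hi
  choose τ hτ hτ' using h1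
  have hmem : ∀ i, EndsAtInput σ (τ i) ↔ EndsAtInput σ i := by
    intro i
    by_cases hi : EndsAtInput σ i
    · rw [hτ i hi]
    · exact (endsAtInput_iff_of_eq_inl (hτ' i hi)).symm
  have hinj : Function.Injective τ := by
    intro i j hij
    by_cases hi : EndsAtInput σ i
    · have hj := (hmem j).1 (hij ▸ (hmem i).2 hi)
      rwa [hτ i hi, hτ j hj] at hij
    · have hj : ¬ EndsAtInput σ j := fun hj => hi ((hmem i).1 (hij ▸ (hmem j).2 hj))
      exact hσ (by rw [hτ' i hi, hτ' j hj, hij])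
  exact ⟨Equiv.ofBijective τ (Finite.injective_iff_bijective.1 hinj), hτ, hτ'⟩

/-- If some input-reachable state lies outside `W`, an edge leads from `W` or an input out of `W`. -/
theorem exists_adj_of_inputReachable {W : Set (Fin n)} {x : Fin n} (hx : x ∉ W)
    (hr : InputReachable A' B' (Sum.inl x)) :
    ∃ f ∉ W, ∃ p : Fin n ⊕ Fin m, (∀ w, p = Sum.inl w → w ∈ W) ∧
      systemAdj A' B' p (Sum.inl f) := by
  obtain ⟨_, ⟨u, rfl⟩, hp⟩ := hr
  generalize hy : (Sum.inl x : Fin n ⊕ Fin m) = y at hp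
  induction hp generalizing x with
  | refl => cases hy
  | @tail b c _ hbc ih =>
    subst hy
    by_cases hb : ∃ w, b = Sum.inl w ∧ w ∉ W
    · obtain ⟨w, rfl, hw⟩ := hb
      exact ih hw rfl
    · push Not at hb
      exact ⟨x, hx, b, hb, hbc⟩

theorem hasObservableRealization_univ {σ : Fin n → Fin n ⊕ Fin m}
    (hσ : Function.Injective σ) (hadj : ∀ i, systemAdj A' B' (σ i) (Sum.inl i))
    (hr : ∀ i, InputReachable A' B' (Sum.inl i)) :
    HasObservableRealization A' B' Set.univ := by
  obtain ⟨τ, hτ, hτ'⟩ := exists_perm_of_matching hσ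
  -- Invariance under `τ` ensures that the cycle of any state outside a maximal `W` misses `W`
  -- entirely, so it can be glued on, contradicting maximality.
  let P : Set (Set (Fin n)) := {W | {i | EndsAtInput σ i} ⊆ W ∧ (∀ i, τ i ∈ W ↔ i ∈ W) ∧
    HasObservableRealization A' B' W}
  have hP : {i | EndsAtInput σ i} ∈ P := by
    refine ⟨subset_rfl, fun i => ?_, hasObservableRealization_endsAtInput hσ hadj⟩
    by_cases hi : EndsAtInput σ i
    · rw [hτ i hi]
    · exact (endsAtInput_iff_of_eq_inl (hτ' i hi)).symm
  obtain ⟨W, ⟨hEW, hτW, hW⟩, hmax⟩ := (Set.toFinite P).exists_maximal ⟨_, hP⟩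
  suffices h : W = Set.univ from h ▸ hW
  by_contra hne
  obtain ⟨x, hx⟩ := (Set.ne_univ_iff_exists_notMem W).1 hne
  obtain ⟨f, hf, p, hp, hpf⟩ := exists_adj_of_inputReachable hx (hr x)
  have hfW : ∀ i, τ.SameCycle f i → i ∉ W := by
    intro i hi
    obtain ⟨k, -, rfl⟩ := hi.exists_pow_eq'
    induction k with
    | zero => simpa using hf
    | succ k ih =>
      rw [pow_succ', Equiv.Perm.mul_apply, hτW]
      exact ih ⟨k, by simp⟩
  have hstar : ∀ i, τ.SameCycle f i → A'.pattern i (τ i) = Entry.star := by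
    intro i hi
    have h1 := hadj i
    rwa [hτ' i fun h => hfW i hi (hEW h)] at h1
  have hnew : HasObservableRealization A' B' (W ∪ {i | τ.SameCycle f i}) := by
    -- The coupling is a single unit weight on the edge from `p` to `f`: in `a` if `p` is a state,
    -- in `β` if it is an input.
    rcases p with w | u
    · refine hW.union_cycle hfW hstar (a := Pi.single w 1) (β := 0) (fun i hi => ?_)
        (.inl (by simp)) (fun i h0 => ?_) (fun _ _ => rfl)
      · exact Pi.single_eq_of_ne (fun h : i = w => hi (h ▸ hp w rfl)) _
      · refine Pi.single_eq_of_ne (fun h : i = w => ?_) _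
        rw [h, ← A'.symm.apply] at h0
        exact Entry.noConfusion (h0.symm.trans hpf)
    · refine hW.union_cycle hfW hstar (a := 0) (β := Pi.single u 1) (fun _ _ => rfl)
        (.inr (by simp)) (fun _ _ => rfl) (fun v h0 => ?_)
      refine Pi.single_eq_of_ne (fun h : v = u => ?_) _
      rw [h] at h0
      exact Entry.noConfusion (h0.symm.trans hpf)
  refine hf (hmax (y := W ∪ {i | τ.SameCycle f i})
    ⟨hEW.trans Set.subset_union_left, fun i => ?_, hnew⟩ Set.subset_union_left (.inr (.refl τ f)))
  exact or_congr (hτW i) Equiv.Perm.sameCycle_apply_right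

/-- Hall's theorem for the in-neighbourhoods of the state vertices. -/
theorem exists_matching_of_ncard_le
    (h : ∀ S : Set (Fin n ⊕ Fin m), S ⊆ stateVertices n m →
      S.ncard ≤ (inNeighborSet (systemDigraph A' B') S).ncard) :
    ∃ σ : Fin n → Fin n ⊕ Fin m, Function.Injective σ ∧
      ∀ i, systemAdj A' B' (σ i) (Sum.inl i) := by
  classical
  let N : Fin n → Finset (Fin n ⊕ Fin m) := fun i =>
    Finset.univ.filter fun p => systemAdj A' B' p (Sum.inl i)
  obtain ⟨σ, hσ, hN⟩ := (Finset.all_card_le_biUnion_card_iff_exists_injective N).1 fun s => by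
    have h1 := h (Sum.inl '' (s : Set (Fin n))) (Set.image_subset_range _ _)
    rw [Set.ncard_image_of_injective _ Sum.inl_injective, Set.ncard_coe_finset] at h1
    refine h1.trans_eq ?_
    rw [← Set.ncard_coe_finset]
    congr 1
    ext p
    simp [inNeighborSet, N, systemDigraph]
  exact ⟨σ, hσ, fun i => by simpa [N] using hN i⟩

end Sufficiency

end StructuralControl

theorem mainTheorem2 {n m : ℕ} (A' : StructuralControl.SymmStructuredMatrix n)
    (B' : StructuralControl.StructuredMatrix n m) :
    StructuralControl.StructurallyControllable A' B' ↔
      ((∀ x ∈ StructuralControl.stateVertices n m, StructuralControl.InputReachable A' B' x) ∧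
        ∀ S : Set (Fin n ⊕ Fin m), S ⊆ StructuralControl.stateVertices n m →
          S.ncard ≤
            (StructuralControl.inNeighborSet (StructuralControl.systemDigraph A' B') S).ncard) := by
  constructor
  · intro h
    refine ⟨?_, fun S hS => ?_⟩
    · rintro _ ⟨i, rfl⟩
      exact h.inputReachable i
    · obtain ⟨T, rfl⟩ := Set.subset_range_iff_exists_image_eq.1 hS
      rw [Set.ncard_image_of_injective _ Sum.inl_injective]
      exact h.ncard_le_inNeighborSet T
  · rintro ⟨hr, hN⟩
    obtain ⟨σ, hσ, hadj⟩ := StructuralControl.exists_matching_of_ncard_le hN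
    obtain ⟨A, B, hA, hB, -, -, hobs⟩ :=
      StructuralControl.hasObservableRealization_univ hσ hadj fun i => hr _ ⟨i, rfl⟩
    exact ⟨A, B, hA, hB, hobs.rank_controllabilityMatrix hA.1⟩
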